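/- Let $f:\{0,1\}^n\times\{0,1\}^n\to\{0,1\}$ be a (total) Boolean function; Alice holds the first argument $x$, Bob the second argument $y$. In every model below the output is obtained at the end by one player, fixed by the protocol, and complexities are worst case. $D(f)$ is the minimal number of bits exchanged in a deterministic protocol computing $f$. $N(f)$ is the minimal number of bits exchanged in a nondeterministic protocol for $f$: each player privately guesses a finite bit string, messages and output may depend on the guesses, and $f(x,y)=1$ if and only if some pair of guesses leads to output $1$. In a quantum protocol there is a finite number of qubits, all initialized to $|0\rangle$, each in the possession of one player; in each round a player applies a unitary transformation, depending on his input, to the qubits in his possession and sends some of these qubits to the other player; at the end one player measures his qubits, and the output is a function of the result. Its cost is the total number of qubits sent. There is no prior entanglement. $NQ(f)$ is the minimal cost of a quantum protocol which, on every input $(x,y)$, outputs $1$ with positive probability if and only if $f(x,y)=1$. $Q_0(f)$ is the minimal cost of a quantum protocol with outputs $0$, $1$ or "give up" which, on every input, outputs the wrong value $1-f(x,y)$ with probability $0$ and gives up with probability at most $1/2$. Theorem. There is an absolute constant $C$ such that for all $n$ and all total $f:\{0,1\}^n\times\{0,1\}^n\to\{0,1\}$ $$D(f)\le C\cdot N(f)\cdot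 NQ(\neg f)\qquad\text{and}\qquad N(f)\cdot NQ(\neg f)\le C\cdot N(f)\cdot Q_0(f),$$ and also $D(f)\le C\cdot N(f)\cdot Q_0(f)$. That is, $D(f)=O(N(f)\cdot NQ(\neg f))=O(N(f)\cdot Q_0(f))$. -/

import Mathlib

/-- The two parties of a communication protocol. -/
inductive Player : Type
  | alice
  | bob
  deriving DecidableEq

namespace Player

/-- The other party. -/
def other : Player → Player
  | alice => bob
  | bob => alice

/-- The input seen by a player when Alice holds `x` and Bob holds `y`. -/
def view {I : Type} (x y : I) : Player → I
  | alice => x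
  | bob => y

end Player

/-! ### Classical protocols -/

/-- The conversation of a two-party protocol, as a tree. At an inner node the player `p` sends one
bit, computed from his own input (and from the conversation so far, which is the position in the
tree). At a leaf the conversation is over; the leaf holds the function by which the player who
announces the result computes it from his own input. -/
inductive CommTree (I : Type) : Type
  | answer (out : I → Bool) : CommTree I
  | send (p : Player) (msg : I → Bool) (next : Bool → CommTree I) : CommTree I

namespace CommTree

/-- The output on the inputs `x`, `y`, where `o` is the player who announces the result. -/
def run {I : Type} (o : Player) (x y : I) : CommTree I → Bool
  | answer out => out (o.view x y)
  | send p msg next => run o x y (next (msg (p.view x y)))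

/-- The worst case number of bits exchanged: the depth of the tree. -/
def cost {I : Type} : CommTree I → ℕ
  | answer _ => 0
  | send _ _ next => 1 + max (cost (next false)) (cost (next true))

end CommTree

/-- A deterministic protocol: a conversation after which a fixed player has the output. -/
structure Protocol (I : Type) : Type where
  outputPlayer : Player
  tree : CommTree I

namespace Protocol

/-- The output of the protocol on the inputs `x` (of Alice) and `y` (of Bob). -/
def run {I : Type} (P : Protocol I) (x y : I) : Bool := P.tree.run P.outputPlayer x y

/-- The worst case number of bits exchanged. -/
def cost {I : Type} (P : Protocol I) : ℕ := P.tree.cost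

/-- The protocol computes `f` without error. -/
def Computes {I : Type} (P : Protocol I) (f : I → I → Bool) : Prop :=
  ∀ x y, P.run x y = f x y

/-- A protocol in which each player holds, besides his input, a privately guessed string of `k`
bits accepts exactly the inputs on which `f` is 1, where acceptance means that some pair of
guesses leads to the output 1. -/
def NondetComputes {I : Type} {k : ℕ} (P : Protocol (I × (Fin k → Bool)))
    (f : I → I → Bool) : Prop :=
  ∀ x y, f x y = true ↔ ∃ a b : Fin k → Bool, P.run (x, a) (y, b) = true

end Protocol

/-- Deterministic communication complexity `D(f)`. -/
noncomputable def detComplexity {I : Type} (f : I → I → Bool) : ℕ∞ :=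
  ⨅ (P : Protocol I) (_ : P.Computes f), (P.cost : ℕ∞)

/-- Nondeterministic communication complexity `N(f)`. -/
noncomputable def nondetComplexity {I : Type} (f : I → I → Bool) : ℕ∞ :=
  ⨅ (k : ℕ) (P : Protocol (I × (Fin k → Bool))) (_ : P.NondetComputes f), (P.cost : ℕ∞)

/-! ### Quantum protocols -/

/-- The classical configurations (computational basis states) of those among `m` qubits that are
in the possession of `p`, where `own q` is the player who possesses qubit `q`. -/
abbrev LocalBasis {m : ℕ} (own : Fin m → Player) (p : Player) : Type :=
  {q : Fin m // own q = p} → Bool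

/-- The configuration of the qubits of `p` in a configuration of all qubits. -/
def localPart {m : ℕ} (own : Fin m → Player) (p : Player) (z : Fin m → Bool) :
    LocalBasis own p :=
  fun q => z q.1

/-- Overwrite the configuration of the qubits of `p` by `w`. -/
def overwrite {m : ℕ} (own : Fin m → Player) (p : Player) (z : Fin m → Bool)
    (w : LocalBasis own p) : Fin m → Bool :=
  fun q => if h : own q = p then w ⟨q, h⟩ else z q

/-- The action of `u ⊗ 1` on a vector of amplitudes of `m` qubits, where the matrix `u` acts on
the qubits of `p` and the identity on all others. -/
noncomputable def applyLocal {m : ℕ} (own : Fin m → Player) (p : Player)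
    (u : Matrix (LocalBasis own p) (LocalBasis own p) ℂ) (ψ : (Fin m → Bool) → ℂ) :
    (Fin m → Bool) → ℂ :=
  fun z => ∑ w : LocalBasis own p, u (localPart own p z) w * ψ (overwrite own p z w)

/-- The possession of the qubits after those in `S` have been handed to `p`. -/
def handOver {m : ℕ} (own : Fin m → Player) (S : Finset (Fin m)) (p : Player) :
    Fin m → Player :=
  fun q => if q ∈ S then p else own q

/-- The rounds of a quantum protocol on `m` qubits with outputs in `Ω`, started when the qubits
are possessed according to `own`. In a round the player `p` applies a unitary transformation,
chosen according to his input, to the qubits in his possession and then sends the qubits in `S`,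
all of them his, to the other player (`S` may be empty). At the end one player measures his
qubits in the computational basis, and the output is a function of the result. -/
inductive QRounds (I Ω : Type) {m : ℕ} : (Fin m → Player) → Type
  | measure {own : Fin m → Player} (p : Player) (out : LocalBasis own p → Ω) : QRounds I Ω own
  | round {own : Fin m → Player} (p : Player)
      (U : I → Matrix.unitaryGroup (LocalBasis own p) ℂ)
      (S : Finset (Fin m)) (hS : ∀ q ∈ S, own q = p)
      (next : QRounds I Ω (handOver own S p.other)) : QRounds I Ω own

namespace QRounds

/-- The probability of the output `o` on the inputs `x`, `y` when the rounds are started in the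
state `ψ`. -/
noncomputable def prob {I Ω : Type} [DecidableEq Ω] {m : ℕ} (x y : I) (o : Ω) :
    {own : Fin m → Player} → QRounds I Ω own → ((Fin m → Bool) → ℂ) → ℝ
  | own, measure p out, ψ =>
      ∑ z : Fin m → Bool, if out (localPart own p z) = o then ‖ψ z‖ ^ 2 else 0
  | own, round p U _ _ next, ψ =>
      prob x y o next (applyLocal own p (U (p.view x y)).1 ψ)

/-- The number of qubits sent. -/
def cost {I Ω : Type} {m : ℕ} : {own : Fin m → Player} → QRounds I Ω own → ℕ
  | _, measure _ _ => 0
  | _, round _ _ S _ next => S.card + cost next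

end QRounds

/-- A quantum protocol with inputs from `I` for each player and outputs in `Ω`: finitely many
qubits, each in the possession of one player at the beginning, and the rounds. There is no prior
entanglement, since all qubits are initialized to `|0⟩`. -/
structure QProtocol (I Ω : Type) : Type where
  qubits : ℕ
  own : Fin qubits → Player
  rounds : QRounds I Ω own

namespace QProtocol

/-- The probability of the output `o` on the inputs `x`, `y`, all qubits being initialized
to `|0⟩`. -/
noncomputable def prob {I Ω : Type} [DecidableEq Ω] (P : QProtocol I Ω) (x y : I) (o : Ω) : ℝ :=
  P.rounds.prob x y o (Pi.single (fun _ => false) 1)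

/-- The number of qubits sent. -/
def cost {I Ω : Type} (P : QProtocol I Ω) : ℕ := P.rounds.cost

/-- The protocol outputs 1 with positive probability exactly where `f` is 1. -/
def NondetComputes {I : Type} (P : QProtocol I Bool) (f : I → I → Bool) : Prop :=
  ∀ x y, f x y = true ↔ 0 < P.prob x y true

/-- The protocol never errs on `f` and gives up (output `none`) with probability at most `ε`. -/
def LasVegasComputes {I : Type} (P : QProtocol I (Option Bool)) (ε : ℝ)
    (f : I → I → Bool) : Prop :=
  ∀ x y, P.prob x y (some (!f x y)) = 0 ∧ P.prob x y none ≤ ε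

end QProtocol

/-- Nondeterministic quantum communication complexity `NQ(f)`. -/
noncomputable def nondetQComplexity {I : Type} (f : I → I → Bool) : ℕ∞ :=
  ⨅ (P : QProtocol I Bool) (_ : P.NondetComputes f), (P.cost : ℕ∞)

/-- Las Vegas quantum communication complexity `Q_{0,ε}(f)`. -/
noncomputable def lasVegasQComplexityWith {I : Type} (ε : ℝ) (f : I → I → Bool) : ℕ∞ :=
  ⨅ (P : QProtocol I (Option Bool)) (_ : P.LasVegasComputes ε f), (P.cost : ℕ∞)

/-- Las Vegas quantum communication complexity `Q_0(f) = Q_{0,1/2}(f)`. -/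
noncomputable def lasVegasQComplexity {I : Type} (f : I → I → Bool) : ℕ∞ :=
  lasVegasQComplexityWith (1 / 2) f

/-! A nondeterministic protocol of cost `k` covers the inputs with `f = 1` by at most `2 ^ k`
rectangles. The acceptance probabilities of a nondeterministic quantum protocol of cost `q` for `¬f`
form a matrix that vanishes exactly where `f = 1`. Its rank is at most `2 ^ (2q)`: each qubit sent
at most doubles the number of product terms in the joint state (`IsLocalSum.handOver`), and passing
to probabilities squares that number (`IsLocalSum.exists_measure_eq_sum`).

On a rectangle `A × B` of the cover the matrix vanishes, so the ranks of its row strip and of its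
column strip add up to at most the whole rank (`finrank_rowSpace_add_le`), and one of them is at
most half. Hence, where `f = 1`, some player can name a rectangle that contains his input and whose
strip halves the rank; the players continue on that strip. If neither can, `f = 0`; once the rank is
0, `f = 1`. This takes at most `2q + 1` stages of `k + 2` bits (`exists_commTree_of_cover`).

A Las Vegas protocol for `f` that accepts only on the answer 0 is a nondeterministic protocol for
`¬f`, which gives the bounds with `Q_0`. -/

/-! ### Sending a message, and covers by rectangles -/

namespace CommTree

variable {I : Type}

theorem exists_send_bits (p : Player) (c : ℕ) :
    ∀ (k : ℕ) (g : I → Fin k → Bool) (next : (Fin k → Bool) → CommTree I),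
      (∀ t, (next t).cost ≤ c) →
      ∃ T : CommTree I, T.cost ≤ k + c ∧
        ∀ o x y, T.run o x y = (next (g (p.view x y))).run o x y := by
  intro k
  induction k with
  | zero =>
    intro g next h
    refine ⟨next Fin.elim0, by simpa using h _, fun o x y => ?_⟩
    rw [Subsingleton.elim (g (p.view x y)) Fin.elim0]
  | succ k ih =>
    intro g next h
    choose T hT hrun using fun b : Bool =>
      ih (fun x => Fin.tail (g x)) (fun t => next (Fin.cons b t)) (fun t => h _)
    refine ⟨send p (fun x => g x 0) T, ?_, fun o x y => ?_⟩
    · have h0 := hT false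
      have h1 := hT true
      simp only [cost]
      omega
    · simp only [run, hrun, Fin.cons_self_tail]

/-- A player can send an element of a type with at most `2 ^ k` elements with `k` bits. -/
theorem exists_send {ι : Type} [Fintype ι] [Nonempty ι] {k : ℕ} (hι : Fintype.card ι ≤ 2 ^ k)
    (p : Player) {c : ℕ} (g : I → ι) (next : ι → CommTree I) (h : ∀ t, (next t).cost ≤ c) :
    ∃ T : CommTree I, T.cost ≤ k + c ∧
      ∀ o x y, T.run o x y = (next (g (p.view x y))).run o x y := by
  obtain ⟨e⟩ : Nonempty (ι ↪ (Fin k → Bool)) :=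
    Function.Embedding.nonempty_of_card_le (by simpa using hι)
  -- Strings outside the range of `e` are decoded arbitrarily; they are never sent.
  obtain ⟨T, hT, hrun⟩ := exists_send_bits p c k (fun x => e (g x))
    (fun t => next (Function.invFun e t)) (fun t => h _)
  refine ⟨T, hT, fun o x y => ?_⟩
  rw [hrun, Function.leftInverse_invFun e.injective]

/-- The inputs accepted by a conversation of cost `k` are the union of at most `2 ^ k`
rectangles. -/
theorem exists_cover (o : Player) (T : CommTree I) :
    ∃ (ι : Type) (_ : Fintype ι) (A B : ι → I → Prop), Fintype.card ι ≤ 2 ^ T.cost ∧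
      ∀ x y, T.run o x y = true ↔ ∃ t, A t x ∧ B t y := by
  induction T with
  | answer out =>
    cases o with
    | alice =>
      exact ⟨Unit, inferInstance, fun _ x => out x = true, fun _ _ => True, by simp [cost],
        fun x y => by simp [run, Player.view]⟩
    | bob =>
      exact ⟨Unit, inferInstance, fun _ _ => True, fun _ x => out x = true, by simp [cost],
        fun x y => by simp [run, Player.view]⟩
  | send p msg next ih =>
    choose ι hι A B hcard hrun using ih
    -- The covers of the two subtrees are united. The condition on the bit sent restricts only the
    -- sender's side, so rectangles stay rectangles.
    have hc : Fintype.card (Σ b, ι b) ≤ 2 ^ (send p msg next).cost := by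
      have h0 := (hcard false).trans
        (Nat.pow_le_pow_right two_pos (le_max_left _ (next true).cost))
      have h1 := (hcard true).trans
        (Nat.pow_le_pow_right two_pos (le_max_right (next false).cost _))
      rw [Fintype.card_sigma, Fintype.sum_bool, cost, add_comm 1, pow_succ]
      omega
    cases p with
    | alice =>
      refine ⟨Σ b, ι b, inferInstance, fun t x => msg x = t.1 ∧ A t.1 t.2 x,
        fun t y => B t.1 t.2 y, hc, fun x y => ?_⟩
      simp only [run, Player.view, hrun]
      constructor
      · rintro ⟨t, hA, hB⟩
        exact ⟨⟨_, t⟩, ⟨rfl, hA⟩, hB⟩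
      · rintro ⟨⟨b, t⟩, ⟨rfl, hA⟩, hB⟩
        exact ⟨t, hA, hB⟩
    | bob =>
      refine ⟨Σ b, ι b, inferInstance, fun t x => A t.1 t.2 x,
        fun t y => msg y = t.1 ∧ B t.1 t.2 y, hc, fun x y => ?_⟩
      simp only [run, Player.view, hrun]
      constructor
      · rintro ⟨t, hA, hB⟩
        exact ⟨⟨_, t⟩, hA, rfl, hB⟩
      · rintro ⟨⟨b, t⟩, hA, rfl, hB⟩
        exact ⟨t, hA, hB⟩

end CommTree

/-- Since the guesses are private, projecting them away on each side maps a rectangle to a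
rectangle. The number of guessed bits does not matter. -/
theorem Protocol.NondetComputes.exists_cover {I : Type} {k : ℕ}
    {P : Protocol (I × (Fin k → Bool))} {f : I → I → Bool} (hP : P.NondetComputes f) :
    ∃ (ι : Type) (_ : Fintype ι) (A B : ι → I → Prop), Fintype.card ι ≤ 2 ^ P.cost ∧
      ∀ x y, f x y = true ↔ ∃ t, A t x ∧ B t y := by
  obtain ⟨ι, hι, A, B, hcard, hrun⟩ := CommTree.exists_cover P.outputPlayer P.tree
  refine ⟨ι, hι, fun t x => ∃ a, A t (x, a), fun t y => ∃ b, B t (y, b), hcard, fun x y => ?_⟩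
  rw [hP x y]
  simp only [Protocol.run, hrun]
  constructor
  · rintro ⟨a, b, t, hA, hB⟩
    exact ⟨t, ⟨a, hA⟩, ⟨b, hB⟩⟩
  · rintro ⟨t, ⟨a, hA⟩, ⟨b, hB⟩⟩
    exact ⟨a, b, t, hA, hB⟩

theorem detComplexity_eq_zero_of_eq_view {I : Type} {f : I → I → Bool} {p : Player} {g : I → Bool}
    (h : ∀ x y, f x y = g (p.view x y)) : detComplexity f = 0 := by
  refine le_antisymm (iInf₂_le_of_le ⟨p, .answer g⟩ (fun x y => (h x y).symm) ?_) zero_le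
  simp [Protocol.cost, CommTree.cost]

/-- Without communication, the existence of an accepting guess is decided by the output player's
input alone. This case is separate because the bound `(2q + 1)(k + 2)` is not `O(kq)` when a cost is
0. -/
theorem Protocol.NondetComputes.detComplexity_eq_zero {I : Type} {k : ℕ}
    {P : Protocol (I × (Fin k → Bool))} {f : I → I → Bool} (hP : P.NondetComputes f)
    (h0 : P.cost = 0) : detComplexity f = 0 := by
  classical
  obtain ⟨o, T⟩ := P
  cases T with
  | send p msg next => simp [Protocol.cost, CommTree.cost] at h0
  | answer out =>
    refine detComplexity_eq_zero_of_eq_view (p := o)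
      (g := fun x => decide (∃ a, out (x, a) = true)) fun x y => ?_
    rw [Bool.eq_iff_iff, hP x y, decide_eq_true_iff]
    cases o <;> simp [Protocol.run, CommTree.run, Player.view]

/-! ### Rank and the deterministic protocol -/

section Rank

open Module

variable {I : Type} [Finite I]

/-- The space spanned by the rows of the submatrix of `M` on `X × Y`. -/
noncomputable def rowSpace (M : I → I → ℂ) (X Y : Set I) : Submodule ℂ (I → ℂ) :=
  Submodule.span ℂ ((fun x => Y.indicator (M x)) '' X)

/-- If the block `A × B` of a matrix vanishes, then the ranks of the strips of rows in `A` and of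
columns in `B` add up to at most the rank of the matrix. -/
theorem finrank_rowSpace_add_le (M : I → I → ℂ) (X Y A B : Set I)
    (h : ∀ x ∈ A, ∀ y ∈ B, M x y = 0) :
    finrank ℂ (rowSpace M (X ∩ A) Y) + finrank ℂ (rowSpace M X (Y ∩ B)) ≤
      finrank ℂ (rowSpace M X Y) := by
  classical
  -- Rank-nullity for restriction to the columns in `B`: the image of the row space is that of the
  -- column strip, and the rows in `A` lie in the kernel.
  let res : (I → ℂ) →ₗ[ℂ] (I → ℂ) :=
    { toFun := fun v => B.indicator v
      map_add' := fun v w => Set.indicator_add B v w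
      map_smul' := fun c v => Set.indicator_const_smul B c v }
  have hres (x : I) : res (Y.indicator (M x)) = (Y ∩ B).indicator (M x) := by
    change B.indicator (Y.indicator (M x)) = _
    rw [Set.indicator_indicator, Set.inter_comm]
  have himage : rowSpace M X (Y ∩ B) = (rowSpace M X Y).map res := by
    rw [rowSpace, rowSpace, Submodule.map_span, Set.image_image]
    simp only [hres]
  have hker : rowSpace M (X ∩ A) Y ≤ LinearMap.ker res ⊓ rowSpace M X Y := by
    refine le_inf (Submodule.span_le.2 ?_)
      (Submodule.span_mono (Set.image_mono Set.inter_subset_left))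
    rintro _ ⟨x, ⟨-, hx⟩, rfl⟩
    change res _ = 0
    rw [hres]
    funext y
    by_cases hy : y ∈ Y ∩ B
    · simp [hy, h x hx y hy.2]
    · simp [hy]
  have hrn := LinearMap.finrank_range_add_finrank_ker (res.domRestrict (rowSpace M X Y))
  rw [LinearMap.range_domRestrict, ← himage] at hrn
  have hle : rowSpace M (X ∩ A) Y ≤
      (LinearMap.ker (res.domRestrict (rowSpace M X Y))).map (rowSpace M X Y).subtype :=
    fun v hv => ⟨⟨v, (hker hv).2⟩, (hker hv).1, rfl⟩
  have := (Submodule.finrank_mono hle).trans (Submodule.finrank_map_le _ _)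
  omega

theorem eq_zero_of_finrank_rowSpace_eq_zero {M : I → I → ℂ} {X Y : Set I}
    (h : finrank ℂ (rowSpace M X Y) = 0) {x y : I} (hx : x ∈ X) (hy : y ∈ Y) : M x y = 0 := by
  have hmem : Y.indicator (M x) ∈ rowSpace M X Y := Submodule.subset_span ⟨x, hx, rfl⟩
  rw [Submodule.finrank_eq_zero.1 h, Submodule.mem_bot] at hmem
  simpa [hy] using congrFun hmem y

theorem finrank_rowSpace_le_card {κ : Type} [Fintype κ] (G H : κ → I → ℂ) (X Y : Set I) :
    finrank ℂ (rowSpace (fun x y => ∑ i, G i x * H i y) X Y) ≤ Fintype.card κ := by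
  have hle : rowSpace (fun x y => ∑ i, G i x * H i y) X Y ≤
      Submodule.span ℂ (Set.range fun i => Y.indicator (H i)) := by
    refine Submodule.span_le.2 ?_
    rintro _ ⟨x, -, rfl⟩
    have : Y.indicator (fun y => ∑ i, G i x * H i y) = ∑ i, G i x • Y.indicator (H i) := by
      funext y
      by_cases hy : y ∈ Y <;> simp [hy]
    change Y.indicator (fun y => ∑ i, G i x * H i y) ∈ _
    rw [this]
    exact Submodule.sum_mem _ fun i _ =>
      Submodule.smul_mem _ _ (Submodule.subset_span ⟨i, rfl⟩)
  exact (Submodule.finrank_mono hle).trans (finrank_range_le_card _)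

/-- Given a cover of `f` by `2 ^ k` rectangles and a matrix which vanishes exactly where `f` is 1,
the players can compute `f` by repeatedly naming a rectangle that halves the rank. -/
theorem exists_commTree_of_cover {f : I → I → Bool} {ι : Type} [Fintype ι] {k : ℕ}
    (hι : Fintype.card ι ≤ 2 ^ k) {A B : ι → I → Prop}
    (hcover : ∀ x y, f x y = true ↔ ∃ t, A t x ∧ B t y) {M : I → I → ℂ}
    (hM : ∀ x y, f x y = true ↔ M x y = 0) (d : ℕ) :
    ∀ X Y : Set I, finrank ℂ (rowSpace M X Y) < 2 ^ d →
      ∃ T : CommTree I, T.cost ≤ d * (k + 2) ∧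
        ∀ o, ∀ x ∈ X, ∀ y ∈ Y, T.run o x y = f x y := by
  classical
  induction d with
  | zero =>
    intro X Y h
    refine ⟨.answer fun _ => true, by simp [CommTree.cost], fun o x hx y hy => ?_⟩
    exact ((hM x y).2 (eq_zero_of_finrank_rowSpace_eq_zero (by simpa using h) hx hy)).symm
  | succ d ih =>
    intro X Y h
    -- An empty cover forces `f = 0`; `CommTree.exists_send` needs an inhabited index type.
    rcases isEmpty_or_nonempty ι with hι0 | hι0
    · refine ⟨.answer fun _ => false, by simp [CommTree.cost], fun o x _ y _ => ?_⟩
      have : ¬ f x y = true := fun h' => hι0.elim ((hcover x y).1 h').choose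
      rw [Bool.not_eq_true] at this
      exact this.symm
    -- The sets, the cover and the matrix are known to both players, so each can test from his own
    -- input alone whether a rectangle contains it and has a strip of small rank.
    let a (t : ι) (x : I) : Prop :=
      A t x ∧ finrank ℂ (rowSpace M (X ∩ {x | A t x}) Y) < 2 ^ d
    let b (t : ι) (y : I) : Prop :=
      B t y ∧ finrank ℂ (rowSpace M X (Y ∩ {y | B t y})) < 2 ^ d
    have hnextA (t : ι) : ∃ T : CommTree I, T.cost ≤ d * (k + 2) ∧ ∀ o, ∀ x ∈ X, ∀ y ∈ Y,
        a t x → T.run o x y = f x y := by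
      by_cases ht : finrank ℂ (rowSpace M (X ∩ {x | A t x}) Y) < 2 ^ d
      · obtain ⟨T, hT, hrun⟩ := ih _ _ ht
        exact ⟨T, hT, fun o x hx y hy hxt => hrun o x ⟨hx, hxt.1⟩ y hy⟩
      · exact ⟨.answer fun _ => true, by simp [CommTree.cost],
          fun o x hx y hy hxt => absurd hxt.2 ht⟩
    have hnextB (t : ι) : ∃ T : CommTree I, T.cost ≤ d * (k + 2) ∧ ∀ o, ∀ x ∈ X, ∀ y ∈ Y,
        b t y → T.run o x y = f x y := by
      by_cases ht : finrank ℂ (rowSpace M X (Y ∩ {y | B t y})) < 2 ^ d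
      · obtain ⟨T, hT, hrun⟩ := ih _ _ ht
        exact ⟨T, hT, fun o x hx y hy hyt => hrun o x hx y ⟨hy, hyt.1⟩⟩
      · exact ⟨.answer fun _ => true, by simp [CommTree.cost],
          fun o x hx y hy hyt => absurd hyt.2 ht⟩
    choose nextA hnextA hrunA using hnextA
    choose nextB hnextB hrunB using hnextB
    obtain ⟨TA, hTA, hTArun⟩ := CommTree.exists_send hι .alice
      (fun x => Classical.epsilon fun t => a t x) nextA hnextA
    obtain ⟨TB, hTB, hTBrun⟩ := CommTree.exists_send hι .bob
      (fun y => Classical.epsilon fun t => b t y) nextB hnextB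
    -- The longest path has a flag bit of each player and `k` bits naming a rectangle, hence `k + 2`
    -- per stage. An arbitrary choice by `Classical.epsilon` is never used, since the flag is then
    -- false.
    refine ⟨.send .alice (fun x => decide (∃ t, a t x)) fun s => bif s then TA else
      .send .bob (fun y => decide (∃ t, b t y)) fun s => bif s then TB else
        .answer fun _ => false, ?_, fun o x hx y hy => ?_⟩
    · simp only [CommTree.cost, cond_true, cond_false]
      rw [add_mul, one_mul]
      omega
    · by_cases ha : ∃ t, a t x
      · simp only [CommTree.run, Player.view, ha, decide_true, cond_true]
        rw [hTArun]
        exact hrunA _ o x hx y hy (Classical.epsilon_spec ha)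
      by_cases hb : ∃ t, b t y
      · simp only [CommTree.run, Player.view, ha, hb, decide_true, cond_true, decide_false,
          cond_false]
        rw [hTBrun]
        exact hrunB _ o x hx y hy (Classical.epsilon_spec hb)
      · simp only [CommTree.run, Player.view, ha, hb, decide_false, cond_false]
        symm
        rw [← Bool.not_eq_true]
        intro hf
        obtain ⟨t, hAt, hBt⟩ := (hcover x y).1 hf
        -- If `f x y = 1`, a rectangle containing `(x, y)` would have both strips of rank at least
        -- `2 ^ d`, although the total rank is below `2 ^ (d + 1)`.
        have hsum := finrank_rowSpace_add_le M X Y {x | A t x} {y | B t y}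
          fun x' hx' y' hy' => (hM x' y').1 ((hcover x' y').2 ⟨t, hx', hy'⟩)
        have ha' : ¬ finrank ℂ (rowSpace M (X ∩ {x | A t x}) Y) < 2 ^ d :=
          fun h' => ha ⟨t, hAt, h'⟩
        have hb' : ¬ finrank ℂ (rowSpace M X (Y ∩ {y | B t y})) < 2 ^ d :=
          fun h' => hb ⟨t, hBt, h'⟩
        rw [pow_succ] at h
        omega

end Rank

/-! ### States of the two parties -/

section States

variable {m : ℕ} {own : Fin m → Player} {p : Player}

theorem Player.ne_iff_eq_other {p q : Player} : q ≠ p ↔ q = p.other := by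
  cases p <;> cases q <;> simp [Player.other]

theorem localPart_overwrite (z : Fin m → Bool) (w : LocalBasis own p) :
    localPart own p (overwrite own p z w) = w := by
  funext q
  simp [localPart, overwrite, q.2]

theorem localPart_other_overwrite (z : Fin m → Bool) (w : LocalBasis own p) :
    localPart own p.other (overwrite own p z w) = localPart own p.other z := by
  funext q
  have : own q.1 ≠ p := Player.ne_iff_eq_other.2 q.2
  simp [localPart, overwrite, this]

/-- A configuration of all qubits consists of the configurations of the qubits of the two
players. -/
def splitEquiv (own : Fin m → Player) (p : Player) :
    (Fin m → Bool) ≃ LocalBasis own p × LocalBasis own p.other where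
  toFun z := (localPart own p z, localPart own p.other z)
  invFun w := overwrite own p (overwrite own p.other (fun _ => false) w.2) w.1
  left_inv z := by
    funext q
    by_cases h : own q = p
    · simp [overwrite, localPart, h]
    · simp [overwrite, localPart, Player.ne_iff_eq_other.1 h]
  right_inv w := by
    exact Prod.ext (localPart_overwrite _ _)
      ((localPart_other_overwrite _ _).trans (localPart_overwrite _ _))

theorem overwrite_splitEquiv_symm (w w' : LocalBasis own p) (v : LocalBasis own p.other) :
    overwrite own p ((splitEquiv own p).symm (w, v)) w' = (splitEquiv own p).symm (w', v) := by
  apply (splitEquiv own p).injective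
  rw [Equiv.apply_symm_apply]
  refine Prod.ext (localPart_overwrite _ _) ?_
  have := congrArg Prod.snd ((splitEquiv own p).apply_symm_apply (w, v))
  exact (localPart_other_overwrite _ _).trans this

theorem localPart_splitEquiv_symm (w : LocalBasis own p) (v : LocalBasis own p.other) :
    localPart own p ((splitEquiv own p).symm (w, v)) = w :=
  congrArg Prod.fst ((splitEquiv own p).apply_symm_apply (w, v))

theorem localPart_other_splitEquiv_symm (w : LocalBasis own p) (v : LocalBasis own p.other) :
    localPart own p.other ((splitEquiv own p).symm (w, v)) = v :=
  congrArg Prod.snd ((splitEquiv own p).apply_symm_apply (w, v))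

theorem sum_norm_sq_mulVec_of_mem_unitaryGroup {n : Type*} [Fintype n] [DecidableEq n]
    {u : Matrix n n ℂ} (hu : u ∈ Matrix.unitaryGroup n ℂ) (v : n → ℂ) :
    ∑ i, ‖∑ j, u i j * v j‖ ^ 2 = ∑ i, ‖v i‖ ^ 2 := by
  have key (w : n → ℂ) : ((∑ i, ‖w i‖ ^ 2 : ℝ) : ℂ) = star w ⬝ᵥ w := by
    simp [dotProduct, Complex.conj_mul']
  have h : star (u.mulVec v) ⬝ᵥ u.mulVec v = star v ⬝ᵥ v := by
    rw [Matrix.star_mulVec, ← Matrix.dotProduct_mulVec, Matrix.mulVec_mulVec,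
      ← Matrix.star_eq_conjTranspose, Matrix.mem_unitaryGroup_iff'.1 hu, Matrix.one_mulVec]
  rw [← key, ← key] at h
  exact_mod_cast h

theorem sum_norm_sq_applyLocal (u : Matrix.unitaryGroup (LocalBasis own p) ℂ)
    (ψ : (Fin m → Bool) → ℂ) :
    ∑ z, ‖applyLocal own p u.1 ψ z‖ ^ 2 = ∑ z, ‖ψ z‖ ^ 2 := by
  rw [← (splitEquiv own p).symm.sum_comp, ← (splitEquiv own p).symm.sum_comp (fun z => ‖ψ z‖ ^ 2),
    Fintype.sum_prod_type_right, Fintype.sum_prod_type_right]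
  refine Finset.sum_congr rfl fun v _ => ?_
  simp only [applyLocal, overwrite_splitEquiv_symm, localPart_splitEquiv_symm]
  exact sum_norm_sq_mulVec_of_mem_unitaryGroup u.2 fun w => ψ ((splitEquiv own p).symm (w, v))

/-- `F` depends only on the configuration of the qubits of `p`. -/
def IsLocal (own : Fin m → Player) (p : Player) {α : Type} (F : (Fin m → Bool) → α) : Prop :=
  ∀ z z', localPart own p z = localPart own p z' → F z = F z'

theorem IsLocal.apply_overwrite {α : Type} {F : (Fin m → Bool) → α} (hF : IsLocal own p.other F)
    (z : Fin m → Bool) (w : LocalBasis own p) : F (overwrite own p z w) = F z :=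
  hF _ _ (localPart_other_overwrite z w)

/-- The sum over configurations is a double sum over the two players' parts and factorizes. The
all-`false` filler is arbitrary: locality makes it irrelevant. -/
theorem sum_mul_of_isLocal {a b : (Fin m → Bool) → ℂ} (ha : IsLocal own p a)
    (hb : IsLocal own p.other b) :
    ∑ z, a z * b z =
      (∑ w, a ((splitEquiv own p).symm (w, fun _ => false))) *
        ∑ v, b ((splitEquiv own p).symm (fun _ => false, v)) := by
  rw [← (splitEquiv own p).symm.sum_comp, Fintype.sum_prod_type, Finset.sum_mul_sum]
  refine Finset.sum_congr rfl fun w _ => Finset.sum_congr rfl fun v _ => ?_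
  congr 1
  · exact ha _ _ (by rw [localPart_splitEquiv_symm, localPart_splitEquiv_symm])
  · exact hb _ _ (by rw [localPart_other_splitEquiv_symm, localPart_other_splitEquiv_symm])

/-- A family of states, indexed by the inputs, is a sum of at most `r` products of vectors that
the two players can prepare on their own. -/
def IsLocalSum {I : Type} (own : Fin m → Player) (r : ℕ) (ψ : I → I → (Fin m → Bool) → ℂ) :
    Prop :=
  ∃ (ι : Type) (_ : Fintype ι) (F : Player → ι → I → (Fin m → Bool) → ℂ),
    Fintype.card ι ≤ r ∧ (∀ p i x, IsLocal own p (F p i x)) ∧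
      ∀ x y z, ψ x y z = ∑ i, F .alice i x z * F .bob i y z

/-- Allows arguments about the acting player `p` to be given once instead of separately for Alice
and Bob. -/
theorem mul_view_eq {I ι : Type} (F : Player → ι → I → (Fin m → Bool) → ℂ) (p : Player) (i : ι)
    (x y : I) (z z' : Fin m → Bool) (h : z = z') :
    F .alice i x z * F .bob i y z' =
      F p i (p.view x y) z * F p.other i (p.other.view x y) z' := by
  subst h
  cases p
  · rfl
  · exact mul_comm _ _

/-- By linearity the operator acts on the factor of `p` in each term, because the other factor does
not see the overwritten qubits. -/
theorem IsLocalSum.applyLocal {I : Type} {r : ℕ} {ψ : I → I → (Fin m → Bool) → ℂ}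
    (h : IsLocalSum own r ψ) (u : I → Matrix (LocalBasis own p) (LocalBasis own p) ℂ) :
    IsLocalSum own r (fun x y => _root_.applyLocal own p (u (p.view x y)) (ψ x y)) := by
  obtain ⟨ι, hι, F, hcard, hF, hψ⟩ := h
  refine ⟨ι, hι, fun q i x => if q = p then _root_.applyLocal own p (u x) (F q i x) else F q i x,
    hcard, fun q i x => ?_, fun x y z => ?_⟩
  · dsimp only
    split_ifs with hq
    · subst hq
      intro z z' hz
      refine Finset.sum_congr rfl fun w _ => ?_
      rw [hz, hF _ _ _ _ _ ((localPart_overwrite z w).trans (localPart_overwrite z' w).symm)]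
    · exact hF q i x
  · have hne : p.other ≠ p := Player.ne_iff_eq_other.2 rfl
    have hview (i : ι) := mul_view_eq (fun q i x => if q = p then
      _root_.applyLocal own p (u x) (F q i x) else F q i x) p i x y z z rfl
    simp only [hview, if_true, if_neg hne]
    simp only [_root_.applyLocal, hψ, mul_view_eq F p _ _ _ _ _ rfl,
      (hF _ _ _).apply_overwrite, Finset.mul_sum, Finset.sum_mul]
    rw [Finset.sum_comm]
    simp only [mul_assoc]

/-- Each term is split according to the values `s` of the qubits in `S`: the sender's factor gets
`s` hardwired and no longer depends on these qubits, while the receiver's factor is multiplied by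
the indicator that they equal `s`. -/
theorem IsLocalSum.handOver {I : Type} {r : ℕ} {ψ : I → I → (Fin m → Bool) → ℂ}
    (h : IsLocalSum own r ψ) {S : Finset (Fin m)} (hS : ∀ q ∈ S, own q = p) :
    IsLocalSum (handOver own S p.other) (r * 2 ^ S.card) ψ := by
  classical
  obtain ⟨ι, hι, F, hcard, hF, hψ⟩ := h
  have hne : p.other ≠ p := Player.ne_iff_eq_other.2 rfl
  let put (z : Fin m → Bool) (s : S → Bool) : Fin m → Bool :=
    fun q => if hq : q ∈ S then s ⟨q, hq⟩ else z q
  let F' : Player → ι × (S → Bool) → I → (Fin m → Bool) → ℂ := fun q i x z =>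
    if q = p then F q i.1 x (put z i.2)
    else if (fun j : S => z j) = i.2 then F q i.1 x z else 0
  refine ⟨ι × (S → Bool), inferInstance, F', ?_, fun q i x => ?_, fun x y z => ?_⟩
  · simpa [-mul_le_mul_iff_left] using Nat.mul_le_mul_right (2 ^ S.card) hcard
  · intro z z' hz
    have hz' (j : Fin m) (hj : _root_.handOver own S p.other j = q) : z j = z' j :=
      congrFun hz ⟨j, hj⟩
    by_cases hq : q = p
    · subst hq
      simp only [F', if_true]
      refine hF _ _ _ _ _ (funext fun j => ?_)
      by_cases hj : j.1 ∈ S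
      · simp [localPart, put, hj]
      · simpa [localPart, put, hj] using hz' j (by simp [_root_.handOver, hj, j.2])
    · have hq' := Player.ne_iff_eq_other.1 hq
      subst hq'
      have h1 : (fun j : S => z j) = fun j : S => z' j :=
        funext fun j => hz' j (by simp [_root_.handOver])
      have h2 : F p.other i.1 x z = F p.other i.1 x z' := by
        refine hF _ _ _ _ _ (funext fun j => hz' j ?_)
        have hj : j.1 ∉ S := fun hj => hne (j.2.symm.trans (hS _ hj))
        simp [_root_.handOver, hj, j.2]
      simp only [F', if_neg hq, h1, h2]
  · have hput : put z (fun j : S => z j) = z := by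
      funext j
      simp [put]
    simp only [hψ, mul_view_eq F p _ _ _ _ _ rfl, mul_view_eq F' p _ _ _ _ _ rfl,
      Fintype.sum_prod_type]
    refine Finset.sum_congr rfl fun i _ => ?_
    simp [F', hne, hput]

/-- The probabilities of an outcome of a measurement by one player form a matrix of rank at most
the square of the number of summands. -/
theorem IsLocalSum.exists_measure_eq_sum {I Ω : Type} [DecidableEq Ω] {r : ℕ}
    {ψ : I → I → (Fin m → Bool) → ℂ} (h : IsLocalSum own r ψ) (out : LocalBasis own p → Ω)
    (o : Ω) :
    ∃ (κ : Type) (_ : Fintype κ) (G H : κ → I → ℂ), Fintype.card κ ≤ r ^ 2 ∧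
      ∀ x y, ((∑ z, if out (localPart own p z) = o then ‖ψ x y z‖ ^ 2 else 0 : ℝ) : ℂ) =
        ∑ i, G i x * H i y := by
  obtain ⟨ι, hι, F, hcard, hF, hψ⟩ := h
  suffices ∃ (G : Player → ι × ι → I → ℂ), ∀ x y,
      ((∑ z, if out (localPart own p z) = o then ‖ψ x y z‖ ^ 2 else 0 : ℝ) : ℂ) =
        ∑ i, G p i (p.view x y) * G p.other i (p.other.view x y) by
    obtain ⟨G, hG⟩ := this
    refine ⟨ι × ι, inferInstance, G .alice, G .bob, ?_, fun x y => ?_⟩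
    · rw [Fintype.card_prod, sq]
      exact Nat.mul_le_mul hcard hcard
    · rw [hG]
      refine Finset.sum_congr rfl fun i _ => ?_
      cases p
      · rfl
      · exact mul_comm _ _
  have hne : p.other ≠ p := Player.ne_iff_eq_other.2 rfl
  -- Expanding `ψ * conj ψ` gives one term per pair of indices. The condition on the outcome is
  -- local to `p` and joins his factor.
  let a (i : ι × ι) (x : I) (z : Fin m → Bool) : ℂ :=
    if out (localPart own p z) = o then F p i.1 x z * starRingEnd ℂ (F p i.2 x z) else 0
  let b (i : ι × ι) (y : I) (z : Fin m → Bool) : ℂ :=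
    F p.other i.1 y z * starRingEnd ℂ (F p.other i.2 y z)
  have ha (i x) : IsLocal own p (a i x) := by
    intro z z' hz
    simp only [a, hz, hF p _ _ z z' hz]
  have hb (i y) : IsLocal own p.other (b i y) := by
    intro z z' hz
    simp only [b, hF p.other _ _ z z' hz]
  refine ⟨fun q i x => if q = p then
      ∑ w, a i x ((splitEquiv own p).symm (w, fun _ => false))
    else ∑ v, b i x ((splitEquiv own p).symm (fun _ => false, v)), fun x y => ?_⟩
  simp only [if_true, if_neg hne, ← sum_mul_of_isLocal (ha _ _) (hb _ _)]
  rw [Finset.sum_comm, Complex.ofReal_sum]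
  refine Finset.sum_congr rfl fun z _ => ?_
  by_cases hz : out (localPart own p z) = o
  · simp only [a, b, hz, if_true, Complex.ofReal_pow, ← Complex.mul_conj', hψ,
      mul_view_eq F p _ _ _ _ _ rfl, map_sum, map_mul, Finset.sum_mul_sum,
      Fintype.sum_prod_type]
    refine Finset.sum_congr rfl fun i _ => Finset.sum_congr rfl fun j _ => ?_
    ring
  · simp [a, hz]

/-- On a product state the outcome of a measurement by `p` does not depend on the input of the
other player. -/
theorem IsLocalSum.exists_measure_pos_iff {I Ω : Type} [DecidableEq Ω]
    {ψ : I → I → (Fin m → Bool) → ℂ} (h : IsLocalSum own 1 ψ)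
    (hnorm : ∀ x y, ∑ z, ‖ψ x y z‖ ^ 2 = 1) (out : LocalBasis own p → Ω) (o : Ω) :
    ∃ g : I → Prop, ∀ x y,
      0 < (∑ z, if out (localPart own p z) = o then ‖ψ x y z‖ ^ 2 else 0) ↔
        g (p.view x y) := by
  obtain ⟨ι, hι, F, hcard, hF, hψ⟩ := h
  have := Fintype.card_le_one_iff_subsingleton.1 hcard
  refine ⟨fun x => ∃ z i, out (localPart own p z) = o ∧ F p i x z ≠ 0, fun x y => ?_⟩
  -- The norm provides a configuration where the other player's factor is nonzero. Overwriting the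
  -- part of `p` by any configuration on which his own factor is nonzero stays in the support.
  obtain ⟨z', hz'⟩ : ∃ z, ψ x y z ≠ 0 := by
    by_contra! h0
    simpa [h0] using hnorm x y
  obtain ⟨i, -, -⟩ := Finset.exists_ne_zero_of_sum_ne_zero (hψ x y z' ▸ hz')
  have hψ' (z) : ψ x y z = F p i (p.view x y) z * F p.other i (p.other.view x y) z := by
    rw [hψ, Fintype.sum_subsingleton _ i, mul_view_eq F p _ _ _ _ _ rfl]
  rw [hψ'] at hz'
  constructor
  · intro hpos
    obtain ⟨z, -, hz⟩ := Finset.exists_ne_zero_of_sum_ne_zero hpos.ne'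
    split_ifs at hz with hout
    · refine ⟨z, i, hout, fun h0 => hz ?_⟩
      simp [hψ', h0]
    · exact absurd rfl hz
  · rintro ⟨z, j, hout, hz⟩
    rw [Subsingleton.elim j i] at hz
    refine Finset.sum_pos' (fun z _ => by positivity)
      ⟨overwrite own p z' (localPart own p z), Finset.mem_univ _, ?_⟩
    have h1 : F p i (p.view x y) (overwrite own p z' (localPart own p z)) ≠ 0 := by
      rwa [hF p i _ _ z (localPart_overwrite _ _)]
    rw [localPart_overwrite, if_pos hout, hψ', (hF p.other i _).apply_overwrite]
    have := mul_ne_zero h1 (right_ne_zero_of_mul hz')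
    positivity

end States

/-! ### Quantum protocols -/

namespace QRounds

variable {I Ω : Type} {m : ℕ}

/-- The state measured at the end of a quantum protocol. -/
theorem exists_final_state [DecidableEq Ω] {own : Fin m → Player} (R : QRounds I Ω own) :
    ∀ {r : ℕ} {ψ : I → I → (Fin m → Bool) → ℂ}, IsLocalSum own r ψ →
      ∃ (own' : Fin m → Player) (p : Player) (out : LocalBasis own' p → Ω)
        (φ : I → I → (Fin m → Bool) → ℂ), IsLocalSum own' (r * 2 ^ R.cost) φ ∧
        (∀ x y, ∑ z, ‖φ x y z‖ ^ 2 = ∑ z, ‖ψ x y z‖ ^ 2) ∧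
        ∀ x y o, R.prob x y o (ψ x y) =
          ∑ z, if out (localPart own' p z) = o then ‖φ x y z‖ ^ 2 else 0 := by
  induction R with
  | @measure own p out =>
    intro r ψ h
    exact ⟨own, p, out, ψ, by simpa [cost] using h, fun _ _ => rfl, fun _ _ _ => rfl⟩
  | round p U S hS next ih =>
    intro r ψ h
    obtain ⟨own', q, out, φ, hφ, hnorm, hprob⟩ :=
      ih ((h.applyLocal fun x => (U x).1).handOver hS)
    refine ⟨own', q, out, φ, ?_, fun x y => ?_, fun x y o => hprob x y o⟩
    · rwa [mul_assoc, ← pow_add] at hφ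
    · rw [hnorm, sum_norm_sq_applyLocal]

theorem sum_prob [DecidableEq Ω] [Fintype Ω] (x y : I) {own : Fin m → Player} (R : QRounds I Ω own) :
    ∀ ψ : (Fin m → Bool) → ℂ, ∑ o, R.prob x y o ψ = ∑ z, ‖ψ z‖ ^ 2 := by
  induction R with
  | measure p out =>
    intro ψ
    simp only [prob]
    rw [Finset.sum_comm]
    simp
  | round p U S hS next ih =>
    intro ψ
    simp only [prob, ih]
    exact sum_norm_sq_applyLocal _ _

/-- The same rounds with another output function. -/
def mapOut {Ω' : Type} (g : Ω → Ω') : {own : Fin m → Player} → QRounds I Ω own → QRounds I Ω' own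
  | _, measure p out => measure p fun w => g (out w)
  | _, round p U S hS next => round p U S hS (mapOut g next)

theorem cost_mapOut {Ω' : Type} (g : Ω → Ω') {own : Fin m → Player} (R : QRounds I Ω own) :
    (R.mapOut g).cost = R.cost := by
  induction R with
  | measure p out => rfl
  | round p U S hS next ih => simp [mapOut, cost, ih]

theorem prob_mapOut {Ω' : Type} [DecidableEq Ω] [DecidableEq Ω'] {g : Ω → Ω'} {o : Ω} {o' : Ω'}
    (h : ∀ ω, g ω = o' ↔ ω = o) (x y : I) {own : Fin m → Player} (R : QRounds I Ω own) :
    ∀ ψ : (Fin m → Bool) → ℂ, (R.mapOut g).prob x y o' ψ = R.prob x y o ψ := by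
  induction R with
  | measure p out => intro ψ; simp [mapOut, prob, h]
  | round p U S hS next ih => intro ψ; simp [mapOut, prob, ih]

end QRounds

/-! ### Comparison of the complexities -/

namespace QProtocol

variable {I Ω : Type} [DecidableEq Ω]

/-- Absence of prior entanglement: the initial state is a single product, of the indicators that
each player's qubits are all 0. -/
theorem isLocalSum_init {m : ℕ} (own : Fin m → Player) :
    IsLocalSum (I := I) own 1 fun _ _ => Pi.single (fun _ => false) 1 := by
  classical
  refine ⟨Unit, inferInstance, fun p _ _ z =>
    if localPart own p z = fun _ => false then 1 else 0, by simp, ?_, fun _ _ z => ?_⟩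
  · intro p _ _ z z' hz
    simp only [hz]
  · have : z = (fun _ => false) ↔ localPart own .alice z = (fun _ => false) ∧
        localPart own .bob z = fun _ => false := by
      constructor
      · rintro rfl
        exact ⟨rfl, rfl⟩
      · rintro ⟨ha, hb⟩
        funext q
        cases h : own q
        · exact congrFun ha ⟨q, h⟩
        · exact congrFun hb ⟨q, h⟩
    simp [Pi.single_apply, this, ← ite_and, and_comm]

theorem sum_norm_sq_init {m : ℕ} :
    ∑ z, ‖(Pi.single (fun _ => false) 1 : (Fin m → Bool) → ℂ) z‖ ^ 2 = 1 := by
  rw [Finset.sum_eq_single (fun _ => false)] <;> simp +contextual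

theorem sum_prob [Fintype Ω] (P : QProtocol I Ω) (x y : I) : ∑ o, P.prob x y o = 1 :=
  (P.rounds.sum_prob x y _).trans sum_norm_sq_init

/-- The matrix of probabilities of an output has rank at most `(2 ^ q) ^ 2`, where `q` is the
number of qubits sent. -/
theorem exists_prob_eq_sum (P : QProtocol I Ω) (o : Ω) :
    ∃ (κ : Type) (_ : Fintype κ) (G H : κ → I → ℂ), Fintype.card κ ≤ (2 ^ P.cost) ^ 2 ∧
      ∀ x y, (P.prob x y o : ℂ) = ∑ i, G i x * H i y := by
  obtain ⟨own, p, out, φ, hφ, -, hprob⟩ :=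
    P.rounds.exists_final_state (isLocalSum_init (I := I) P.own)
  obtain ⟨κ, hκ, G, H, hcard, hsum⟩ := hφ.exists_measure_eq_sum out o
  rw [one_mul] at hcard
  exact ⟨κ, hκ, G, H, hcard, fun x y => (congrArg _ (hprob x y o)).trans (hsum x y)⟩

/-- With no qubit sent the final state is still a product, so whether acceptance is possible depends
only on the measuring player's input. -/
theorem NondetComputes.detComplexity_eq_zero {P : QProtocol I Bool} {f : I → I → Bool}
    (hP : P.NondetComputes fun x y => !f x y) (h0 : P.cost = 0) : detComplexity f = 0 := by
  classical
  obtain ⟨own, p, out, φ, hφ, hnorm, hprob⟩ :=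
    P.rounds.exists_final_state (isLocalSum_init (I := I) P.own)
  have hc : P.rounds.cost = 0 := h0
  rw [hc, pow_zero, one_mul] at hφ
  obtain ⟨g, hg⟩ := hφ.exists_measure_pos_iff
    (fun x y => (hnorm x y).trans sum_norm_sq_init) out true
  refine detComplexity_eq_zero_of_eq_view (p := p) (g := fun x => !decide (g x)) fun x y => ?_
  have h : (!f x y) = decide (g (p.view x y)) := by
    rw [Bool.eq_iff_iff, hP x y, decide_eq_true_iff, ← hg x y, ← hprob]
    rfl
  rw [← h, Bool.not_not]

end QProtocol

theorem detComplexity_le_of_protocols {I : Type} [Finite I] {f : I → I → Bool} {k : ℕ}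
    {P : Protocol (I × (Fin k → Bool))} (hP : P.NondetComputes f) {Q : QProtocol I Bool}
    (hQ : Q.NondetComputes fun x y => !f x y) :
    detComplexity f ≤ ((9 * (P.cost * Q.cost) : ℕ) : ℕ∞) := by
  rcases Nat.eq_zero_or_pos P.cost with h0 | hPpos
  · simp [hP.detComplexity_eq_zero h0]
  rcases Nat.eq_zero_or_pos Q.cost with h0 | hQpos
  · simp [hQ.detComplexity_eq_zero h0]
  obtain ⟨ι, hι, A, B, hcard, hcover⟩ := hP.exists_cover
  obtain ⟨κ, hκ, G, H, hκcard, hprob⟩ := Q.exists_prob_eq_sum true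
  have hnonneg (x y : I) : 0 ≤ Q.prob x y true := by
    obtain ⟨own, p, out, φ, -, -, hprob⟩ :=
      Q.rounds.exists_final_state (QProtocol.isLocalSum_init (I := I) Q.own)
    exact (Finset.sum_nonneg fun z _ => by positivity).trans_eq (hprob x y true).symm
  have hM (x y : I) : f x y = true ↔ ∑ i, G i x * H i y = 0 := by
    have h := hQ x y
    rw [← hprob, Complex.ofReal_eq_zero, ← not_iff_not, Bool.not_eq_true, ← Bool.not_eq_true', h]
    exact ⟨ne_of_gt, fun h => lt_of_le_of_ne (hnonneg x y) (Ne.symm h)⟩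
  -- The recursion needs a strict bound on the rank, hence the exponent `2 * Q.cost + 1`.
  have hrank : Module.finrank ℂ
      (rowSpace (fun x y => ∑ i, G i x * H i y) Set.univ Set.univ) < 2 ^ (2 * Q.cost + 1) := by
    refine ((finrank_rowSpace_le_card G H _ _).trans hκcard).trans_lt ?_
    rw [← pow_mul, mul_comm]
    exact Nat.pow_lt_pow_right one_lt_two (Nat.lt_succ_self _)
  obtain ⟨T, hT, hrun⟩ := exists_commTree_of_cover hcard hcover hM _ _ _ hrank
  refine iInf₂_le_of_le ⟨.alice, T⟩ (fun x y => hrun _ x trivial y trivial) ?_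
  refine Nat.cast_le.2 (hT.trans ?_)
  calc (2 * Q.cost + 1) * (P.cost + 2) ≤ (3 * Q.cost) * (3 * P.cost) :=
        Nat.mul_le_mul (by omega) (by omega)
    _ = 9 * (P.cost * Q.cost) := by ring

theorem detComplexity_le_mul {I : Type} [Finite I] (f : I → I → Bool) :
    detComplexity f ≤
      9 * (nondetComplexity f * nondetQComplexity fun x y => !f x y) := by
  have hN (a : ℕ∞) (h : nondetComplexity f < a) : ∃ (k : ℕ)
      (P : Protocol (I × (Fin k → Bool))), P.NondetComputes f ∧ (P.cost : ℕ∞) < a := by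
    simpa only [nondetComplexity, iInf_lt_iff, exists_prop] using h
  have hQ (a : ℕ∞) (h : (nondetQComplexity fun x y => !f x y) < a) : ∃ Q : QProtocol I Bool,
      (Q.NondetComputes fun x y => !f x y) ∧ (Q.cost : ℕ∞) < a := by
    simpa only [nondetQComplexity, iInf_lt_iff, exists_prop] using h
  -- Zero factors are treated before infinite ones because `0 * ⊤ = 0` in `ℕ∞`.
  by_cases hN0 : nondetComplexity f = 0
  · obtain ⟨k, P, hP, hcost⟩ := hN 1 (by simp [hN0])
    simp [hP.detComplexity_eq_zero (Nat.lt_one_iff.1 (by exact_mod_cast hcost))]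
  by_cases hQ0 : (nondetQComplexity fun x y => !f x y) = 0
  · obtain ⟨Q, hQ, hcost⟩ := hQ 1 (by simp [hQ0])
    simp [hQ.detComplexity_eq_zero (Nat.lt_one_iff.1 (by exact_mod_cast hcost))]
  by_cases hNtop : nondetComplexity f = ⊤
  · simp [hNtop, ENat.top_mul hQ0]
  by_cases hQtop : (nondetQComplexity fun x y => !f x y) = ⊤
  · simp [hQtop, ENat.mul_top hN0]
  obtain ⟨k, P, hP, hPcost⟩ := hN _ (ENat.lt_add_one_iff hNtop |>.2 le_rfl)
  obtain ⟨Q, hQ, hQcost⟩ := hQ _ (ENat.lt_add_one_iff hQtop |>.2 le_rfl)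
  refine (detComplexity_le_of_protocols hP hQ).trans ?_
  push_cast
  gcongr
  · exact (ENat.lt_add_one_iff hNtop).1 hPcost
  · exact (ENat.lt_add_one_iff hQtop).1 hQcost

/-- Accept exactly on the answer `some false`. Where `f = 1` this answer is an error and has
probability 0; where `f = 0` only giving up competes with it, so its probability is at least 1/2. -/
theorem nondetQComplexity_not_le_lasVegasQComplexity {I : Type} (f : I → I → Bool) :
    (nondetQComplexity fun x y => !f x y) ≤ lasVegasQComplexity f := by
  refine le_iInf₂ fun P hP => ?_
  let g : Option Bool → Bool := fun o => decide (o = some false)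
  have hg (o : Option Bool) : g o = true ↔ o = some false := by simp [g]
  refine iInf₂_le_of_le ⟨P.qubits, P.own, P.rounds.mapOut g⟩ (fun x y => ?_)
    (Nat.cast_le.2 (P.rounds.cost_mapOut g).le)
  have hprob : QProtocol.prob ⟨P.qubits, P.own, P.rounds.mapOut g⟩ x y true =
      P.prob x y (some false) := QRounds.prob_mapOut hg x y P.rounds _
  rw [hprob]
  obtain ⟨herr, hnone⟩ := hP x y
  have hsum := P.sum_prob x y
  rw [Fintype.sum_option, Fintype.sum_bool] at hsum
  cases hf : f x y
  · rw [hf, Bool.not_false] at herr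
    refine iff_of_true (by simp [hf]) ?_
    linarith
  · rw [hf, Bool.not_true] at herr
    simp [herr, hf]

theorem theorem1 :
    ∃ C : ℕ, ∀ (n : ℕ) (f : (Fin n → Bool) → (Fin n → Bool) → Bool),
      detComplexity f ≤ C * (nondetComplexity f * nondetQComplexity (fun x y => !f x y)) ∧
      nondetComplexity f * nondetQComplexity (fun x y => !f x y) ≤
        C * (nondetComplexity f * lasVegasQComplexity f) ∧
      detComplexity f ≤ C * (nondetComplexity f * lasVegasQComplexity f) := by
  refine ⟨9, fun n f => ?_⟩
  have h1 := detComplexity_le_mul f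
  have h2 : nondetComplexity f * nondetQComplexity (fun x y => !f x y) ≤
      nondetComplexity f * lasVegasQComplexity f := by
    gcongr
    exact nondetQComplexity_not_le_lasVegasQComplexity f
  refine ⟨h1, h2.trans (le_mul_of_one_le_left zero_le (by norm_num)), h1.trans ?_⟩
  gcongr
  norm_num
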